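/- Let $\mathcal F$ be a complex Hilbert space, $I$ its identity operator and $\mathcal L(\mathcal F)$ the space of bounded linear operators on $\mathcal F$. **Definitions.** A function $G\colon[0,\infty)\to\mathcal L(\mathcal F)$ is *Chernoff-tangent* to a linear operator $L\colon Dom(L)\to\mathcal F$, $Dom(L)\subset\mathcal F$, if: (CT1) $t\mapsto G(t)f$ is continuous on $[0,\infty)$ for every $f\in\mathcal F$; (CT2) $G(0)=I$; (CT3) there is a dense subspace $\mathcal D\subset\mathcal F$ such that for every $f\in\mathcal D$ the limit $G'(0)f=\lim_{t\to+0}(G(t)f-f)/t$ exists; (CT4) the operator $(G'(0),\mathcal D)$ is closable and its closure is $(L,Dom(L))$. A *$C_0$-group* is a map $V\colon\mathbb R\to\mathcal L(\mathcal F)$ with $V(0)=I$, $V(t+s)=V(t)V(s)$ for all $t,s\in\mathbb R$, and $t\mapsto V(t)f$ continuous for every $f$; its *generator* is $f\mapsto\lim_{t\to0}(V(t)f-f)/t$, with domain the set of all $f$ for which this limit exists. Two maps $G_1,G_2\colon\mathbb R\to\mathcal L(\mathcal F)$ are *Chernoff-equivalent* if $G_1(0)=G_2(0)=I$ and for all $f\in\mathcal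 F$ and $T>0$ $$\lim_{n\to\infty}\sup_{t\in[-T,T]}\left\|G_1(t/n)^nf-G_2(t/n)^nf\right\|=0 .$$ **Theorem.** Let $L_k\colon Dom(L_k)\to\mathcal F$, $Dom(L_k)\subset\mathcal F$ ($k=1,\dots,m$) be linear (bounded or unbounded) operators, let $a_1,\dots,a_m$ be non-zero complex numbers, and suppose that 1) for each $k$ the function $S_k\colon[0,\infty)\to\mathcal L(\mathcal F)$ is Chernoff-tangent to $L_k$; 2) in 1) the same dense subspace $\mathcal D\subset\mathcal F$ can be taken in (CT3) and (CT4) for all $k$; 3) the operator $(a_1L_1+\dots+a_mL_m,\mathcal D)$ is closable and its closure $(L,Dom(L))$ is self-adjoint; 4) for each $t\ge0$ the operator $S(t)=a_1S_1(t)+\dots+a_mS_m(t)$ is self-adjoint; 5) the number $a=\sum_{k=1}^ma_k$ is real. Then: 1. There exists a $C_0$-group with generator $iL$; any such group is denoted by $(e^{itL})_{t\in\mathbb R}$ below, and the assertions 3 and 4 hold for it (so it is unique). 2. The following family of bounded linear operators is well defined (with $\mathrm{sign}(0)=0$; the exponential series converges in operator norm for every $t\in\mathbb R$): $$R(t)=\exp\Big[i\sum_{k=1}^ma_k(S_k(|t|)-I)\,\mathrm{sign}(t)\Big]=\exp\big[i(S(|t|)-aI)\,\mathrm{sign}(t)\big].$$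 3. The family $(R(t))_{t\in\mathbb R}$ is Chernoff-equivalent to $(e^{itL})_{t\in\mathbb R}$; moreover, for all $t\in\mathbb R$ and $f\in\mathcal F$, $$e^{itL}f=\lim_{n\to\infty}(R(t/n))^nf .$$ 4. Put $a_{m+1}=-a$ and $S_{m+1}(t)=I$ for all $t\ge0$. Then for each $f\in\mathcal F$ and each $t\in\mathbb R$ $$e^{itL}f=\lim_{n\to\infty}\lim_{j\to\infty}\sum_{p=0}^j\frac{(in\,\mathrm{sign}(t))^p}{p!}\sum_{k_1=1}^{m+1}\dots\sum_{k_p=1}^{m+1}a_{k_1}\cdots a_{k_p}\,S_{k_1}(|t|/n)\circ\dots\circ S_{k_p}(|t|/n)f,$$ $$e^{itL}f=\lim_{n\to\infty}\lim_{p\to\infty}p!\sum_{d=0}^p\frac{(in\,\mathrm{sign}(t))^d}{p^d\,d!\,(p-d)!}\sum_{k_1=1}^{m+1}\dots\sum_{k_d=1}^{m+1}a_{k_1}\cdots a_{k_d}\,S_{k_1}(|t|/n)\circ\dots\circ S_{k_d}(|t|/n)f,$$ where in both formulas all the inner limits (for each $n\ge1$) and the outer limit exist in the norm of $\mathcal F$,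 the term with $p=0$ (respectively $d=0$) of the multiple sum is $f$, and $0^0=1$. -/

import Mathlib

open Filter Topology
open scoped Nat

noncomputable section

namespace QuasiFeynman

variable {F : Type*} [NormedAddCommGroup F]

section Banach

variable [NormedSpace ℂ F]

/-- The (possibly unbounded) operator `A` is closable and its closure is `L`. -/
def HasClosure (A L : F →ₗ.[ℂ] F) : Prop :=
  A.IsClosable ∧ A.closure = L

/-- A `C₀`-group of bounded operators (strongly continuous one-parameter group). -/
structure IsC0Group (V : ℝ → F →L[ℂ] F) : Prop where
  map_zero : V 0 = 1
  map_add : ∀ t s : ℝ, V (t + s) = V t ∘L V s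
  continuous_apply : ∀ f : F, Continuous fun t : ℝ => V t f

/-- `A` is the infinitesimal generator of the one-parameter group `V`: the domain of `A` consists
exactly of the vectors `f` for which `lim_{t → 0} (V t f - f) / t` exists, and `A f` is that
limit. -/
def IsGenerator (V : ℝ → F →L[ℂ] F) (A : F →ₗ.[ℂ] F) : Prop :=
  ∀ f g : F, (f, g) ∈ A.graph ↔
    Tendsto (fun t : ℝ => (t : ℂ)⁻¹ • (V t f - f)) (𝓝[≠] 0) (𝓝 g)

/-- `G` is Chernoff-tangent to the operator `L`, where `D` is a dense subspace that witnesses it.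
A function on `[0, ∞)` is given by a function on `ℝ` whose values at negative reals are
irrelevant. In the last field `A` is the operator `(G'(0), D)`. -/
structure IsChernoffTangentOn (D : Submodule ℂ F) (G : ℝ → F →L[ℂ] F) (L : F →ₗ.[ℂ] F) :
    Prop where
  continuousOn_apply : ∀ f : F, ContinuousOn (fun t : ℝ => G t f) (Set.Ici 0)
  map_zero : G 0 = 1
  dense : Dense (D : Set F)
  hasClosure_deriv : ∃ A : F →ₗ.[ℂ] F, A.domain = D ∧
    (∀ f : A.domain,
      Tendsto (fun t : ℝ => (t : ℂ)⁻¹ • (G t (f : F) - (f : F))) (𝓝[>] 0) (𝓝 (A f))) ∧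
    HasClosure A L

/-- Chernoff-equivalence of two operator-valued mappings defined on `ℝ`; the supremum over
`t ∈ [-T, T]` is taken in `[0, ∞]`. -/
def IsChernoffEquivalent (G₁ G₂ : ℝ → F →L[ℂ] F) : Prop :=
  G₁ 0 = 1 ∧ G₂ 0 = 1 ∧ ∀ f : F, ∀ T : ℝ, 0 < T →
    Tendsto
      (fun n : ℕ => ⨆ t ∈ Set.Icc (-T) T, ‖(G₁ (t / n) ^ n) f - (G₂ (t / n) ^ n) f‖ₑ)
      atTop (𝓝 0)

/-- `lim_{n → ∞} lim_{j → ∞} u n j = l`: for every `n ≥ 1` the inner limit exists, and the inner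
limits converge to `l`. -/
def HasIteratedLimit (u : ℕ → ℕ → F) (l : F) : Prop :=
  ∃ g : ℕ → F, (∀ n : ℕ, 1 ≤ n → Tendsto (u n) atTop (𝓝 (g n))) ∧ Tendsto g atTop (𝓝 l)

variable {m : ℕ}

/-- The bounded operator `i (∑ₖ aₖ (Sₖ(|t|) - I)) sign t`. -/
def exponent (a : Fin m → ℂ) (S : Fin m → ℝ → F →L[ℂ] F) (t : ℝ) : F →L[ℂ] F :=
  (Complex.I * (Real.sign t : ℂ)) • ∑ k, a k • (S k |t| - 1)

/-- `R(t) = exp[i (∑ₖ aₖ (Sₖ(|t|) - I)) sign t]`. -/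
def expFamily (a : Fin m → ℂ) (S : Fin m → ℝ → F →L[ℂ] F) (t : ℝ) : F →L[ℂ] F :=
  NormedSpace.exp (exponent a S t)

/-- The coefficients `a₁, …, aₘ, aₘ₊₁` with `aₘ₊₁ = -(a₁ + ⋯ + aₘ)`. -/
def extCoeff (a : Fin m → ℂ) : Fin (m + 1) → ℂ :=
  Fin.snoc (α := fun _ => ℂ) a (-∑ k, a k)

/-- The families `S₁, …, Sₘ, Sₘ₊₁` with `Sₘ₊₁(t) = I`. -/
def extFamily (S : Fin m → ℝ → F →L[ℂ] F) : Fin (m + 1) → ℝ → F →L[ℂ] F :=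
  Fin.snoc (α := fun _ => ℝ → F →L[ℂ] F) S (fun _ => 1)

/-- `∑_{k₁=1}^{m+1} ⋯ ∑_{k_p=1}^{m+1} a_{k₁} ⋯ a_{k_p} S_{k₁}(s) ∘ ⋯ ∘ S_{k_p}(s) f`
(for `p = 0` this is `f`); the product in `F →L[ℂ] F` is composition. -/
def multiSum (a : Fin m → ℂ) (S : Fin m → ℝ → F →L[ℂ] F) (p : ℕ) (s : ℝ) (f : F) : F :=
  ∑ k : Fin p → Fin (m + 1),
    (∏ i, extCoeff a (k i)) • (List.ofFn fun i => extFamily S (k i) s).prod f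

end Banach

end QuasiFeynman

end

namespace QuasiFeynman

/-! ### The unitary group generated by a bounded self-adjoint operator -/

section MeanValue

variable {E : Type*} [NormedAddCommGroup E] [NormedSpace ℝ E]

/-! For `s > 0` put `Q(s) = (S(s) - a I) / s`, a bounded operator, self-adjoint because `S(s)` is
and `a` is real. Since `sign t = t / |t|`, for `t ≠ 0` the power `R(t/n) ^ n` is exactly the unitary
operator `exp (i t Q(|t|/n))`. Chernoff tangency gives `Q(s) f → L f` for `f` in `D`, and `D` is a
core of `L`. So the claim is a Trotter–Kato statement: strong convergence on a core implies strong
convergence of the resolvents (`tendsto_resolvent`), and Duhamel's formula smoothed by a resolvent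
carries this over to the unitary groups, uniformly for bounded times
(`eventually_norm_expGroup_sub_lt`). The uniformity is essential, since `t` occurs both as the time
and in the parameter `|t|/n`.

The group itself comes from Stone's theorem (`exists_isGroupWithGraph`), proved with commuting
bounded approximants of `L`. The unbounded operator enters only through its graph, a linear relation
equal to its own adjoint. The explicit formulas hold because for fixed `n` the exponent is bounded:
its exponential is both a power series and an Euler limit, whose powers expand into words in the
`S_k`. -/

theorem norm_sub_le_of_norm_hasDerivAt_le {u u' : ℝ → E} {C t : ℝ}
    (hu : ∀ r, HasDerivAt u (u' r) r) (hC : ∀ r, |r| ≤ |t| → ‖u' r‖ ≤ C) :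
    ‖u t - u 0‖ ≤ C * |t| := by
  have h := (convex_Icc (-|t|) |t|).norm_image_sub_le_of_norm_hasDerivWithin_le
    (f := u) (f' := u') (C := C) (x := 0) (y := t)
    (fun r _ => (hu r).hasDerivWithinAt) (fun r hr => hC r (abs_le.2 hr))
    ⟨by simp, by simp⟩ ⟨neg_abs_le t, le_abs_self t⟩
  simpa using h

end MeanValue

section UnitaryGroup

variable {F : Type*} [NormedAddCommGroup F] [InnerProductSpace ℂ F] [CompleteSpace F]

/-- The one-parameter group `exp (i t A)` of a bounded operator `A`. -/
noncomputable def expGroup (A : F →L[ℂ] F) (t : ℝ) : F →L[ℂ] F :=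
  NormedSpace.exp ((t : ℂ) • (Complex.I • A))

variable (A B : F →L[ℂ] F)

@[simp]
theorem expGroup_zero : expGroup A 0 = 1 := by
  simp [expGroup, NormedSpace.exp_zero]

theorem expGroup_add (t s : ℝ) : expGroup A (t + s) = expGroup A t * expGroup A s := by
  let _ : NormedAlgebra ℚ (F →L[ℂ] F) := NormedAlgebra.restrictScalars ℚ ℂ _
  rw [expGroup, Complex.ofReal_add, add_smul, NormedSpace.exp_add_of_commute]
  · rfl
  · exact ((Commute.refl (Complex.I • A)).smul_left _).smul_right _

theorem expGroup_add_apply (t s : ℝ) (f : F) :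
    expGroup A (t + s) f = expGroup A t (expGroup A s f) := by
  rw [expGroup_add]; rfl

theorem expGroup_neg_apply (t : ℝ) (f : F) : expGroup A (-t) (expGroup A t f) = f := by
  rw [← expGroup_add_apply]; simp

theorem expGroup_apply_neg (t : ℝ) (f : F) : expGroup A t (expGroup A (-t) f) = f := by
  rw [← expGroup_add_apply]; simp

theorem hasDerivAt_expGroup (t : ℝ) :
    HasDerivAt (expGroup A) (expGroup A t * (Complex.I • A)) t := by
  have h : HasDerivAt (expGroup A) ((1 : ℂ) • (expGroup A t * (Complex.I • A))) t :=
    (hasDerivAt_exp_smul_const (𝕂 := ℂ) (Complex.I • A) (t : ℂ)).scomp t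
      Complex.ofRealCLM.hasDerivAt
  rwa [one_smul] at h

theorem hasDerivAt_expGroup_apply (t : ℝ) (f : F) :
    HasDerivAt (fun r => expGroup A r f) (expGroup A t (Complex.I • A f)) t := by
  have h := ((ContinuousLinearMap.apply ℂ F f).restrictScalars ℝ).hasFDerivAt.comp_hasDerivAt t
    (hasDerivAt_expGroup A t)
  simpa [Function.comp_def] using h

variable {A B}

theorem adjoint_expGroup (hA : IsSelfAdjoint A) (t : ℝ) :
    star (expGroup A t) = expGroup A (-t) := by
  let _ : NormedAlgebra ℚ (F →L[ℂ] F) := NormedAlgebra.restrictScalars ℚ ℂ _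
  simp [expGroup, NormedSpace.star_exp, hA.star_eq]

theorem inner_expGroup_left (hA : IsSelfAdjoint A) (t : ℝ) (f g : F) :
    inner ℂ (expGroup A t f) g = inner ℂ f (expGroup A (-t) g) := by
  rw [← adjoint_expGroup hA, ContinuousLinearMap.star_eq_adjoint,
    ContinuousLinearMap.adjoint_inner_right]

theorem norm_expGroup_apply (hA : IsSelfAdjoint A) (t : ℝ) (f : F) :
    ‖expGroup A t f‖ = ‖f‖ := by
  have h := inner_expGroup_left hA t f (expGroup A t f)
  rw [expGroup_neg_apply, inner_self_eq_norm_sq_to_K, inner_self_eq_norm_sq_to_K] at h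
  have h2 : ‖expGroup A t f‖ ^ 2 = ‖f‖ ^ 2 := by exact_mod_cast h
  exact (sq_eq_sq₀ (norm_nonneg _) (norm_nonneg _)).1 h2

theorem norm_expGroup_sub_le (hA : IsSelfAdjoint A) (t : ℝ) (f : F) :
    ‖expGroup A t f - f‖ ≤ |t| * ‖A f‖ := by
  have h := norm_sub_le_of_norm_hasDerivAt_le (t := t) (C := ‖A f‖)
    (fun r => hasDerivAt_expGroup_apply A r f)
    (fun r _ => by rw [norm_expGroup_apply hA, norm_smul]; simp)
  simpa [mul_comm] using h

theorem norm_expGroup_sub_expGroup_le (hA : IsSelfAdjoint A) (t s : ℝ) (f : F) :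
    ‖expGroup A t f - expGroup A s f‖ ≤ |t - s| * ‖A f‖ := by
  have h := norm_expGroup_sub_le hA (t - s) f
  rw [← norm_expGroup_apply hA s, map_sub, ← expGroup_add_apply] at h
  simpa using h

/-- Commutation gives `exp(itA) = exp(itB) exp(it(A - B))` with an isometric first factor. This
makes the groups of the Yosida approximants Cauchy. -/
theorem norm_expGroup_sub_expGroup_le_of_commute (hA : IsSelfAdjoint A) (hB : IsSelfAdjoint B)
    (hAB : Commute A B) (t : ℝ) (f : F) :
    ‖expGroup A t f - expGroup B t f‖ ≤ |t| * ‖A f - B f‖ := by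
  let _ : NormedAlgebra ℚ (F →L[ℂ] F) := NormedAlgebra.restrictScalars ℚ ℂ _
  have h := norm_expGroup_sub_le (hA.sub hB) t f
  have h2 : expGroup A t = expGroup B t * expGroup (A - B) t := by
    rw [expGroup, expGroup, expGroup, ← NormedSpace.exp_add_of_commute]
    · congr 1; simp [smul_sub]
    · exact ((((hAB.symm.sub_right (Commute.refl B)).smul_left _).smul_left _).smul_right
        _).smul_right _
  rw [← norm_expGroup_apply hB t, map_sub] at h
  rw [h2]
  simpa using h

/-- A Taylor estimate that survives strong limits of `A` on a core. -/
theorem norm_expGroup_sub_sub_le (hA : IsSelfAdjoint A) (t : ℝ) (f g : F) :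
    ‖expGroup A t f - f - (t : ℂ) • Complex.I • A f‖ ≤
      (2 * ‖A f - g‖ + |t| * ‖A g‖) * |t| := by
  have hd : ∀ r : ℝ, HasDerivAt (fun r : ℝ => expGroup A r f - f - (r : ℂ) • Complex.I • A f)
      (expGroup A r (Complex.I • A f) - Complex.I • A f) r := by
    intro r
    have h1 : HasDerivAt (fun r : ℝ => (r : ℂ) • Complex.I • A f) (Complex.I • A f) r := by
      simpa using (Complex.ofRealCLM.hasDerivAt (x := r)).smul_const (Complex.I • A f)
    exact ((hasDerivAt_expGroup_apply A r f).sub_const f).sub h1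
  have h := norm_sub_le_of_norm_hasDerivAt_le (t := t) (C := 2 * ‖A f - g‖ + |t| * ‖A g‖) hd ?_
  · simpa using h
  intro r hr
  rw [map_smul, ← smul_sub, norm_smul, Complex.norm_I, one_mul]
  -- Estimating `A f` directly would bring in `A (A f)`, uncontrolled when `A` varies; `g` replaces
  -- `A f` and can be taken where `A g` stays bounded.
  calc ‖expGroup A r (A f) - A f‖
      = ‖expGroup A r (A f - g) + (expGroup A r g - g) - (A f - g)‖ := by
        congr 1; rw [map_sub]; abel
    _ ≤ ‖expGroup A r (A f - g)‖ + ‖expGroup A r g - g‖ + ‖A f - g‖ :=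
        (norm_sub_le _ _).trans (by gcongr; exact norm_add_le _ _)
    _ ≤ ‖A f - g‖ + |t| * ‖A g‖ + ‖A f - g‖ := by
        rw [norm_expGroup_apply hA]
        gcongr
        exact (norm_expGroup_sub_le hA r g).trans (by gcongr)
    _ = _ := by ring

end UnitaryGroup

/-! ### Self-adjoint linear relations -/

section Graph

variable {F : Type*} [NormedAddCommGroup F] [InnerProductSpace ℂ F]

/-- A linear relation that coincides with its adjoint. -/
def IsSelfAdjointGraph (Γ : Submodule ℂ (F × F)) : Prop :=
  ∀ f g : F, (f, g) ∈ Γ ↔ ∀ a b : F, (a, b) ∈ Γ → inner ℂ b f = inner ℂ a g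

variable {Γ : Submodule ℂ (F × F)}

theorem isSelfAdjointGraph_graph [CompleteSpace F] {L : F →ₗ.[ℂ] F} (hL : IsSelfAdjoint L) :
    IsSelfAdjointGraph L.graph := by
  intro f g
  have h := LinearPMap.adjoint_graph_eq_graph_adjoint hL.dense_domain
  rw [LinearPMap.isSelfAdjoint_def.1 hL] at h
  rw [h, Submodule.mem_adjoint_iff, ← h]
  simp [sub_eq_zero]

theorem isSelfAdjointGraph_of_isSelfAdjoint [CompleteSpace F] {A : F →L[ℂ] F}
    (hA : IsSelfAdjoint A) : IsSelfAdjointGraph (A : F →ₗ[ℂ] F).graph := by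
  have hs : ∀ x y, inner ℂ (A x) y = inner ℂ x (A y) := fun x y => by
    rw [← ContinuousLinearMap.adjoint_inner_right, ← ContinuousLinearMap.star_eq_adjoint,
      hA.star_eq]
  intro f g
  simp only [LinearMap.mem_graph_iff, ContinuousLinearMap.coe_coe]
  constructor
  · rintro rfl a b rfl
    exact hs a f
  · intro h
    refine ext_inner_left ℂ fun v => ?_
    rw [← h v _ rfl, hs]

namespace IsSelfAdjointGraph

theorem inner_eq (h : IsSelfAdjointGraph Γ) {f g a b : F} (hf : (f, g) ∈ Γ) (ha : (a, b) ∈ Γ) :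
    inner ℂ b f = inner ℂ a g :=
  (h f g).1 hf a b ha

theorem inner_self_im (h : IsSelfAdjointGraph Γ) {f g : F} (hf : (f, g) ∈ Γ) :
    (inner ℂ f g).im = 0 := by
  have h1 := h.inner_eq hf hf
  have h2 := inner_conj_symm (𝕜 := ℂ) f g
  rw [h1] at h2
  exact Complex.conj_eq_iff_im.1 h2

/-- Pythagoras: `⟨g, f⟩` is real by symmetry, so the cross term is purely imaginary and drops out.
-/
theorem norm_add_smul_sq (h : IsSelfAdjointGraph Γ) (c : ℝ) {f g : F} (hf : (f, g) ∈ Γ) :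
    ‖g + (c * Complex.I : ℂ) • f‖ ^ 2 = ‖g‖ ^ 2 + (|c| * ‖f‖) ^ 2 := by
  have h1 : (inner ℂ g f).im = 0 := by rw [h.inner_eq hf hf, h.inner_self_im hf]
  rw [norm_add_sq (𝕜 := ℂ), inner_smul_right, norm_smul]
  simp [h1]

theorem le_norm_add_smul (h : IsSelfAdjointGraph Γ) (c : ℝ) {f g : F} (hf : (f, g) ∈ Γ) :
    |c| * ‖f‖ ≤ ‖g + (c * Complex.I : ℂ) • f‖ := by
  refine le_of_sq_le_sq ?_ (norm_nonneg _)
  rw [h.norm_add_smul_sq c hf]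
  nlinarith [sq_nonneg ‖g‖]

theorem isClosed (h : IsSelfAdjointGraph Γ) : IsClosed (Γ : Set (F × F)) := by
  have : (Γ : Set (F × F)) = ⋂ p ∈ Γ, {q : F × F | inner ℂ p.2 q.1 = inner ℂ p.1 q.2} := by
    ext ⟨f, g⟩
    simp only [SetLike.mem_coe, h f g, Set.mem_iInter, Set.mem_ofPred_eq, Prod.forall]
  rw [this]
  refine isClosed_biInter fun p _ => isClosed_eq ?_ ?_ <;> fun_prop

/-- The resolvent `(L + i c)⁻¹` of a self-adjoint operator. -/
theorem exists_resolvent [CompleteSpace F] (h : IsSelfAdjointGraph Γ)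
    {c : ℝ} (hc : c ≠ 0) :
    ∃ R : F →L[ℂ] F, (∀ f, (R f, f - (c * Complex.I : ℂ) • R f) ∈ Γ) ∧
      (∀ f g, (f, g) ∈ Γ → R (g + (c * Complex.I : ℂ) • f) = f) ∧
      ∀ f, |c| * ‖R f‖ ≤ ‖f‖ := by
  let T : Γ →L[ℂ] F := (ContinuousLinearMap.snd ℂ F F +
    (c * Complex.I : ℂ) • ContinuousLinearMap.fst ℂ F F) ∘L Γ.subtypeL
  have hT : ∀ p : Γ, T p = p.1.2 + (c * Complex.I : ℂ) • p.1.1 := fun p => rfl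
  have hc' : 0 < |c| := abs_pos.2 hc
  have hfst : ∀ p : Γ, |c| * ‖p.1.1‖ ≤ ‖T p‖ := fun p => h.le_norm_add_smul c p.2
  have hsnd : ∀ p : Γ, ‖p.1.2‖ ≤ ‖T p‖ := fun p => by
    refine le_of_sq_le_sq ?_ (norm_nonneg _)
    rw [hT, h.norm_add_smul_sq c p.2]
    nlinarith [sq_nonneg (|c| * ‖p.1.1‖)]
  -- `T = L + ic` on the graph is bounded below, so it is injective with closed range; surjectivity
  -- is then a matter of a trivial orthogonal complement.
  have hanti : AntilipschitzWith (Real.toNNReal (max |c|⁻¹ 1)) T := by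
    refine T.antilipschitz_of_bound fun p => ?_
    rw [Real.coe_toNNReal _ (le_max_of_le_right zero_le_one)]
    change max ‖p.1.1‖ ‖p.1.2‖ ≤ _
    refine max_le ?_ ?_
    · calc ‖p.1.1‖ = |c|⁻¹ * (|c| * ‖p.1.1‖) := by field_simp
        _ ≤ max |c|⁻¹ 1 * ‖T p‖ := by gcongr; exacts [le_max_left _ _, hfst p]
    · calc ‖p.1.2‖ ≤ 1 * ‖T p‖ := by rw [one_mul]; exact hsnd p
        _ ≤ max |c|⁻¹ 1 * ‖T p‖ := by gcongr; exact le_max_right _ _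
  have : CompleteSpace Γ := h.isClosed.completeSpace_coe
  have hker : T.ker = ⊥ := LinearMap.ker_eq_bot.2 hanti.injective
  have hclosed : IsClosed (T.range : Set F) := hanti.isClosed_range T.uniformContinuous
  have : CompleteSpace T.range := hclosed.completeSpace_coe
  have hrange : T.range = ⊤ := by
    rw [← Submodule.orthogonal_eq_bot_iff, Submodule.eq_bot_iff]
    intro v hv
    -- A vector orthogonal to the range of `L + ic` is an eigenvector of `L* = L` for `ic`; the
    -- lower bound for `L - ic` forces it to vanish.
    have hv' : (v, (c * Complex.I : ℂ) • v) ∈ Γ := by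
      rw [h]
      intro a b hab
      have h1 := (Submodule.mem_orthogonal _ _).1 hv _ ⟨⟨(a, b), hab⟩, rfl⟩
      change inner ℂ (T ⟨(a, b), hab⟩) v = 0 at h1
      rw [hT, inner_add_left, inner_smul_left] at h1
      rw [inner_smul_right]
      simp only [map_mul, Complex.conj_ofReal, Complex.conj_I] at h1
      linear_combination h1
    have h2 := h.le_norm_add_smul (-c) hv'
    rw [← add_smul, abs_neg] at h2
    have h3 : ((c * Complex.I : ℂ) + ((-c : ℝ) * Complex.I : ℂ)) = 0 := by push_cast; ring
    rw [h3, zero_smul, norm_zero] at h2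
    exact norm_eq_zero.1 (le_antisymm (nonpos_of_mul_nonpos_right h2 hc') (norm_nonneg _))
  let e := ContinuousLinearEquiv.ofBijective T hker hrange
  have he : ∀ p, e p = T p := fun _ => rfl
  have hsymm : ∀ f, T (e.symm f) = f := fun f => e.apply_symm_apply f
  refine ⟨ContinuousLinearMap.fst ℂ F F ∘L Γ.subtypeL ∘L e.symm, fun f => ?_, fun f g hfg => ?_,
    fun f => ?_⟩
  · change ((e.symm f).1.1, f - (c * Complex.I : ℂ) • (e.symm f).1.1) ∈ Γ
    have h1 : f - (c * Complex.I : ℂ) • (e.symm f).1.1 = (e.symm f).1.2 := by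
      rw [sub_eq_iff_eq_add]
      exact (hsymm f).symm
    rw [h1]
    exact (e.symm f).2
  · change (e.symm (T ⟨(f, g), hfg⟩)).1.1 = f
    rw [← he, e.symm_apply_apply]
  · change |c| * ‖(e.symm f).1.1‖ ≤ ‖f‖
    simpa only [hsymm] using hfst (e.symm f)

end IsSelfAdjointGraph

end Graph

/-! ### Strongly bounded families and dense sets -/

section Dense

variable {E : Type*} [NormedAddCommGroup E] [NormedSpace ℂ E] {ι κ : Type*} {l : Filter ι}

/-- The usual density argument, with the bound `C` independent of `t` so that uniformity over `K`
passes from the dense set to all vectors. -/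
theorem eventually_norm_lt_of_dense {s : Set E} (hs : Dense s) {K : Set κ}
    {P : ι → κ → E →L[ℂ] E} {C : ℝ} (hP : ∀ i t f, ‖P i t f‖ ≤ C * ‖f‖)
    (h : ∀ f ∈ s, ∀ ε > 0, ∀ᶠ i in l, ∀ t ∈ K, ‖P i t f‖ < ε) (f : E) :
    ∀ ε > 0, ∀ᶠ i in l, ∀ t ∈ K, ‖P i t f‖ < ε := by
  intro ε hε
  have hC : 0 < |C| + 1 := by positivity
  obtain ⟨g, hg, hfg⟩ := Metric.dense_iff.1 hs f (ε / 2 / (|C| + 1)) (by positivity)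
  rw [Metric.mem_ball, dist_comm, dist_eq_norm, lt_div_iff₀ hC] at hg
  filter_upwards [h g hfg (ε / 2) (by positivity)] with i hi t ht
  have h1 : P i t f = P i t (f - g) + P i t g := by simp
  have h2 : ‖P i t (f - g)‖ ≤ ‖f - g‖ * (|C| + 1) :=
    (hP i t _).trans (by nlinarith [norm_nonneg (f - g), le_abs_self C])
  calc ‖P i t f‖ ≤ ‖P i t (f - g)‖ + ‖P i t g‖ := h1 ▸ norm_add_le _ _
    _ < ε := by linarith [hi t ht]

theorem tendsto_zero_of_dense {s : Set E} (hs : Dense s) {P : ι → E →L[ℂ] E} {C : ℝ}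
    (hP : ∀ i f, ‖P i f‖ ≤ C * ‖f‖) (h : ∀ f ∈ s, Tendsto (fun i => P i f) l (𝓝 0)) (f : E) :
    Tendsto (fun i => P i f) l (𝓝 0) := by
  have h1 := eventually_norm_lt_of_dense (l := l) (κ := Unit) (K := Set.univ) hs
    (P := fun i _ => P i) (fun i _ => hP i) (fun g hg ε hε => by
      have := (tendsto_zero_iff_norm_tendsto_zero.1 (h g hg)).eventually_lt_const hε
      simpa using this) f
  refine Metric.tendsto_nhds.2 fun ε hε => ?_
  simpa using h1 ε hε

/-- A family of contractions converging along a continuous curve converges uniformly on compact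
sets. -/
theorem tendstoUniformlyOn_of_contraction {R : ι → E →L[ℂ] E} (hR : ∀ i f, ‖R i f‖ ≤ ‖f‖)
    {c w : ℝ → E} (hc : Continuous c) (hw : Continuous w)
    (h : ∀ r, Tendsto (fun i => R i (c r)) l (𝓝 (w r))) {K : Set ℝ} (hK : IsCompact K) :
    TendstoUniformlyOn (fun i r => R i (c r)) w l K := by
  rw [← tendstoLocallyUniformlyOn_iff_tendstoUniformlyOn_of_compact hK]
  refine TendstoLocallyUniformly.tendstoLocallyUniformlyOn ?_
  rw [Metric.tendstoLocallyUniformly_iff]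
  intro ε hε r
  refine ⟨{s | dist (c s) (c r) < ε / 3} ∩ {s | dist (w s) (w r) < ε / 3}, inter_mem
    (Metric.tendsto_nhds.1 hc.continuousAt _ (by positivity))
    (Metric.tendsto_nhds.1 hw.continuousAt _ (by positivity)), ?_⟩
  filter_upwards [Metric.tendsto_nhds.1 (h r) (ε / 3) (by positivity)] with i hi s hs
  have h1 : dist (R i (c r)) (R i (c s)) < ε / 3 := by
    rw [dist_comm, dist_eq_norm, ← map_sub]
    exact (hR i _).trans_lt (by simpa [dist_eq_norm] using hs.1)
  have h2 : dist (w s) (w r) < ε / 3 := hs.2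
  have h3 := dist_triangle4 (w s) (w r) (R i (c r)) (R i (c s))
  rw [dist_comm] at hi
  linarith

end Dense

/-! ### Groups generated by `i` times a self-adjoint relation, and Trotter–Kato convergence -/

section TrotterKato

variable {F : Type*} [NormedAddCommGroup F] [InnerProductSpace ℂ F]

/-- `V` is a `C₀`-group whose generator is `i` times the operator with graph `Γ`. -/
structure IsGroupWithGraph (V : ℝ → F →L[ℂ] F) (Γ : Submodule ℂ (F × F)) : Prop where
  isC0Group : IsC0Group V
  mem_iff : ∀ f g : F, (f, g) ∈ Γ ↔
    Tendsto (fun t : ℝ => (t : ℂ)⁻¹ • (V t f - f)) (𝓝[≠] 0) (𝓝 (Complex.I • g))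

theorem isGenerator_I_smul_iff {V : ℝ → F →L[ℂ] F} {L : F →ₗ.[ℂ] F} :
    IsGenerator V (Complex.I • L) ↔ ∀ f g : F, (f, g) ∈ L.graph ↔
      Tendsto (fun t : ℝ => (t : ℂ)⁻¹ • (V t f - f)) (𝓝[≠] 0) (𝓝 (Complex.I • g)) := by
  have key : ∀ f g : F, (f, Complex.I • g) ∈ (Complex.I • L).graph ↔ (f, g) ∈ L.graph := by
    intro f g
    simp only [LinearPMap.mem_graph_iff]
    constructor
    · rintro ⟨y, rfl, hy⟩
      exact ⟨y, rfl, smul_right_injective F Complex.I_ne_zero hy⟩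
    · rintro ⟨y, rfl, hy⟩
      exact ⟨y, rfl, congrArg (Complex.I • ·) hy⟩
  constructor
  · intro h f g
    rw [← key, h]
  · intro h f g
    obtain ⟨k, rfl⟩ : ∃ k, g = Complex.I • k := ⟨(-Complex.I) • g, by simp [smul_smul]⟩
    rw [key, h]

namespace IsGroupWithGraph

variable {V : ℝ → F →L[ℂ] F} {Γ : Submodule ℂ (F × F)}

theorem map_add_apply (hV : IsGroupWithGraph V Γ) (t s : ℝ) (f : F) :
    V (t + s) f = V t (V s f) := by
  rw [hV.isC0Group.map_add]; rfl

theorem tendsto_comp (hV : IsGroupWithGraph V Γ) {f g : F} (hf : (f, g) ∈ Γ) (t : ℝ) :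
    Tendsto (fun h : ℝ => (h : ℂ)⁻¹ • (V (t + h) f - V t f)) (𝓝[≠] 0)
      (𝓝 (V t (Complex.I • g))) := by
  refine (((V t).continuous.tendsto _).comp ((hV.mem_iff f g).1 hf)).congr fun h => ?_
  simp [hV.map_add_apply]

theorem hasDerivAt (hV : IsGroupWithGraph V Γ) {f g : F} (hf : (f, g) ∈ Γ) (t : ℝ) :
    HasDerivAt (fun r => V r f) (V t (Complex.I • g)) t := by
  rw [hasDerivAt_iff_tendsto_slope_zero]
  refine (hV.tendsto_comp hf t).congr fun h => ?_
  rw [← Complex.ofReal_inv, Complex.coe_smul]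

theorem map_mem (hV : IsGroupWithGraph V Γ) {f g : F} (hf : (f, g) ∈ Γ) (t : ℝ) :
    (V t f, V t g) ∈ Γ := by
  rw [hV.mem_iff, ← map_smul]
  refine (hV.tendsto_comp hf t).congr fun h => ?_
  rw [add_comm, hV.map_add_apply]

/-- The derivative of `‖V r f‖²` on the domain is zero by symmetry of `L`. Unitarity is thus a
consequence of the generator, and the theorem applies to any group generated by `iL`. -/
theorem norm_map (hV : IsGroupWithGraph V Γ) (hΓ : IsSelfAdjointGraph Γ)
    (hd : Dense {f | ∃ g, (f, g) ∈ Γ}) (t : ℝ) (f : F) : ‖V t f‖ = ‖f‖ := by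
  have h : Set.EqOn (fun f => ‖V t f‖) (fun f => ‖f‖) {f | ∃ g, (f, g) ∈ Γ} := by
    rintro f ⟨g, hf⟩
    have hderiv : ∀ r, HasDerivAt (fun r => inner ℂ (V r f) (V r f)) (0 : ℂ) r := by
      intro r
      have h1 := (hV.hasDerivAt hf r).inner ℂ (hV.hasDerivAt hf r)
      rw [map_smul, inner_smul_left, inner_smul_right,
        hΓ.inner_eq (hV.map_mem hf r) (hV.map_mem hf r)] at h1
      simpa using h1
    have h2 := is_const_of_deriv_eq_zero (fun r => (hderiv r).differentiableAt)
      (fun r => (hderiv r).deriv) t 0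
    simp only [hV.isC0Group.map_zero, inner_self_eq_norm_sq_to_K, one_apply_eq_self]
      at h2
    have h3 : ‖V t f‖ ^ 2 = ‖f‖ ^ 2 := by exact_mod_cast h2
    exact (sq_eq_sq₀ (norm_nonneg _) (norm_nonneg _)).1 h3
  exact congrFun (Continuous.ext_on hd (V t).continuous.norm continuous_norm h) f

end IsGroupWithGraph

theorem exists_bounded_resolvent [CompleteSpace F] {A : F →L[ℂ] F} (hA : IsSelfAdjoint A) :
    ∃ R : F →L[ℂ] F, (∀ f, A (R f) = f - Complex.I • R f) ∧
      (∀ f, R (A f + Complex.I • f) = f) ∧ ∀ f, ‖R f‖ ≤ ‖f‖ := by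
  obtain ⟨R, h1, h2, h3⟩ :=
    (isSelfAdjointGraph_of_isSelfAdjoint hA).exists_resolvent (one_ne_zero (α := ℝ))
  refine ⟨R, fun f => ?_, fun f => ?_, fun f => ?_⟩
  · simpa [eq_comm] using h1 f
  · simpa using h2 f (A f) (by simp)
  · simpa using h3 f

/-- Duhamel's estimate, smoothed by the resolvent `R` of `A`. -/
theorem norm_resolvent_sub_le [CompleteSpace F] {V : ℝ → F →L[ℂ] F} {Γ : Submodule ℂ (F × F)}
    (hV : IsGroupWithGraph V Γ) {A R : F →L[ℂ] F} (hA : IsSelfAdjoint A)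
    (hR : ∀ f, A (R f) = f - Complex.I • R f) {f g : F} (hf : (f, g) ∈ Γ) {C t : ℝ}
    (hC : ∀ r, |r| ≤ |t| → ‖R (V r (g + Complex.I • f)) - V r f‖ ≤ C) :
    ‖R (V t f) - expGroup A t (R f)‖ ≤ C * |t| := by
  have hexp : ∀ r, HasDerivAt (fun r : ℝ => expGroup A (-r))
      (-(expGroup A (-r) * (Complex.I • A))) r := fun r => by
    simpa [Function.comp_def] using (hasDerivAt_expGroup A (-r)).scomp r (hasDerivAt_neg r)
  -- The identity `A R = I - iR` removes the operator `A`, whose norm is not uniformly bounded, from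
  -- the derivative; only a resolvent error along the orbit of `V` remains.
  have hderiv : ∀ r, HasDerivAt (fun r => expGroup A (-r) (R (V r f)))
      (expGroup A (-r) (Complex.I • (R (V r (g + Complex.I • f)) - V r f))) r := by
    intro r
    have h1 := (ContinuousLinearMap.restrictScalarsL ℂ F F ℝ ℝ).hasFDerivAt.comp_hasDerivAt r
      (hexp r)
    have h2 := (R.restrictScalars ℝ).hasFDerivAt.comp_hasDerivAt r (hV.hasDerivAt hf r)
    have h3 := h1.clm_apply h2
    refine h3.congr_deriv ?_
    change -(expGroup A (-r) (Complex.I • A (R (V r f)))) +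
      expGroup A (-r) (R (V r (Complex.I • g))) = _
    rw [hR, ← map_neg, ← map_add]
    congr 1
    simp only [map_add, map_smul, smul_sub, smul_add, smul_smul, Complex.I_mul_I]
    module
  have h := norm_sub_le_of_norm_hasDerivAt_le (t := t) (C := C) hderiv (fun r hr => by
    rw [norm_expGroup_apply hA, norm_smul, Complex.norm_I, one_mul]
    exact hC r hr)
  rw [neg_zero, expGroup_zero, hV.isC0Group.map_zero, ← norm_expGroup_apply hA t, map_sub,
    expGroup_apply_neg] at h
  exact h

/-- Strong resolvent convergence from convergence on a core. -/
theorem tendsto_resolvent {ι : Type*} {l : Filter ι} {A R : ι → F →L[ℂ] F}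
    (hR : ∀ i f, R i (A i f + Complex.I • f) = f) (hR' : ∀ i f, ‖R i f‖ ≤ ‖f‖)
    {Γ₀ : Submodule ℂ (F × F)} (hcore : ∀ f g, (f, g) ∈ Γ₀ → Tendsto (fun i => A i f) l (𝓝 g))
    {f g : F} (hf : (f, g) ∈ Γ₀.topologicalClosure) :
    Tendsto (fun i => R i (g + Complex.I • f)) l (𝓝 f) := by
  refine Metric.tendsto_nhds.2 fun ε hε => ?_
  obtain ⟨⟨f₀, g₀⟩, h0, hd⟩ := Metric.mem_closure_iff.1 hf (ε / 4) (by positivity)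
  rw [Prod.dist_eq, max_lt_iff, dist_eq_norm, dist_eq_norm] at hd
  obtain ⟨hd1, hd2⟩ := hd
  filter_upwards [Metric.tendsto_nhds.1 (hcore f₀ g₀ h0) (ε / 4) (by positivity)] with i hi
  rw [dist_comm, dist_eq_norm] at hi
  rw [dist_eq_norm]
  -- Compare with a core element `(f₀, g₀)`, for which `R (A f₀ + i f₀) = f₀` exactly.
  have h1 : R i (g + Complex.I • f) - f = R i (g - g₀) + Complex.I • R i (f - f₀) +
      R i (g₀ - A i f₀) - (f - f₀) := by
    have h2 : R i (A i f₀) = f₀ - Complex.I • R i f₀ := by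
      rw [eq_sub_iff_add_eq, ← map_smul, ← map_add, hR]
    simp only [map_add, map_sub, map_smul, smul_sub, h2]
    abel
  calc ‖R i (g + Complex.I • f) - f‖
      ≤ ‖R i (g - g₀)‖ + ‖Complex.I • R i (f - f₀)‖ + ‖R i (g₀ - A i f₀)‖ + ‖f - f₀‖ := by
        rw [h1]
        exact (norm_sub_le _ _).trans (by gcongr; exact norm_add₃_le)
    _ ≤ ‖g - g₀‖ + ‖f - f₀‖ + ‖g₀ - A i f₀‖ + ‖f - f₀‖ := by
        rw [norm_smul, Complex.norm_I, one_mul]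
        gcongr <;> exact hR' i _
    _ < ε := by simp only at hd1 hd2; linarith

/-- A Trotter–Kato theorem: if bounded self-adjoint operators converge strongly on a core of a
self-adjoint operator, then the unitary groups converge uniformly on compact time intervals. -/
theorem eventually_norm_expGroup_sub_lt [CompleteSpace F] {V : ℝ → F →L[ℂ] F}
    {Γ Γ₀ : Submodule ℂ (F × F)}
    (hV : IsGroupWithGraph V Γ) (hΓ : IsSelfAdjointGraph Γ) (hd : Dense {f | ∃ g, (f, g) ∈ Γ})
    (hΓ₀ : Γ₀.topologicalClosure = Γ) {ι : Type*} {l : Filter ι} {A : ι → F →L[ℂ] F}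
    (hA : ∀ i, IsSelfAdjoint (A i))
    (hcore : ∀ f g, (f, g) ∈ Γ₀ → Tendsto (fun i => A i f) l (𝓝 g)) (T : ℝ) (f : F) :
    ∀ ε > 0, ∀ᶠ i in l, ∀ t ∈ Set.Icc (-T) T, ‖expGroup (A i) t f - V t f‖ < ε := by
  choose R hR1 hR2 hR3 using fun i => exists_bounded_resolvent (hA i)
  have hVn := hV.norm_map hΓ hd
  have hres : ∀ {f g}, (f, g) ∈ Γ → Tendsto (fun i => R i (g + Complex.I • f)) l (𝓝 f) :=
    fun hf => tendsto_resolvent hR2 hR3 hcore (hΓ₀ ▸ hf)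
  have hunif : ∀ {f g}, (f, g) ∈ Γ → ∀ ε > 0, ∀ᶠ i in l, ∀ t ∈ Set.Icc (-T) T,
      ‖R i (V t (g + Complex.I • f)) - V t f‖ < ε := by
    intro f g hf ε hε
    have h1 := tendstoUniformlyOn_of_contraction hR3
      (hV.isC0Group.continuous_apply (g + Complex.I • f)) (hV.isC0Group.continuous_apply f)
      (fun r => by simpa using hres (hV.map_mem hf r)) (isCompact_Icc (a := -T) (b := T))
    filter_upwards [Metric.tendstoUniformlyOn_iff.1 h1 ε hε] with i hi t ht
    rw [← dist_eq_norm, dist_comm]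
    exact hi t ht
  -- Duhamel's estimate on the domain, extended to all vectors by density since the operators have
  -- norm at most 2.
  have hcomm : ∀ f, ∀ ε > 0, ∀ᶠ i in l, ∀ t ∈ Set.Icc (-T) T,
      ‖(R i ∘L V t - expGroup (A i) t ∘L R i) f‖ < ε := by
    refine eventually_norm_lt_of_dense hd (C := 2) (fun i t f => ?_) ?_
    · calc ‖(R i ∘L V t - expGroup (A i) t ∘L R i) f‖
          ≤ ‖R i (V t f)‖ + ‖expGroup (A i) t (R i f)‖ := norm_sub_le _ _
        _ ≤ ‖f‖ + ‖f‖ := by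
            rw [norm_expGroup_apply (hA i)]
            gcongr
            exacts [(hR3 i _).trans (hVn t f).le, hR3 i f]
        _ = 2 * ‖f‖ := by ring
    · rintro f ⟨g, hf⟩ ε hε
      have hT : 0 < |T| + 1 := by positivity
      filter_upwards [hunif hf (ε / (|T| + 1)) (by positivity)] with i hi t ht
      have ht' : |t| ≤ |T| := (abs_le.2 ht).trans (le_abs_self T)
      refine (norm_resolvent_sub_le hV (hA i) (hR1 i) hf (C := ε / (|T| + 1))
        fun r hr => (hi r (abs_le.1 (hr.trans (abs_le.2 ht)))).le).trans_lt ?_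
      rw [div_mul_eq_mul_div, div_lt_iff₀ hT]
      gcongr
      linarith
  have hfinal := eventually_norm_lt_of_dense (l := l) (K := Set.Icc (-T) T) hd (C := 2)
    (P := fun i t => expGroup (A i) t - V t) (fun i t f => ?_) ?_ f
  · simpa using hfinal
  · calc ‖(expGroup (A i) t - V t) f‖ ≤ ‖expGroup (A i) t f‖ + ‖V t f‖ := norm_sub_le _ _
      _ = 2 * ‖f‖ := by rw [norm_expGroup_apply (hA i), hVn]; ring
  · rintro f ⟨g, hf⟩ ε hε
    filter_upwards [hunif hf (ε / 3) (by positivity),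
      hcomm (g + Complex.I • f) (ε / 3) (by positivity),
      Metric.tendsto_nhds.1 (hres hf) (ε / 3) (by positivity)] with i h1 h2 h3 t ht
    rw [dist_comm, dist_eq_norm] at h3
    -- With `h = g + i f` one has `R h ≈ f`, so `f` may be replaced by a vector in the range of the
    -- resolvent, where the intertwining estimate applies.
    have h4 : (expGroup (A i) t - V t) f = expGroup (A i) t (f - R i (g + Complex.I • f)) -
        (R i ∘L V t - expGroup (A i) t ∘L R i) (g + Complex.I • f) +
        (R i (V t (g + Complex.I • f)) - V t f) := by
      simp only [sub_apply, ContinuousLinearMap.comp_apply, map_sub]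
      abel
    calc ‖(expGroup (A i) t - V t) f‖
        ≤ ‖expGroup (A i) t (f - R i (g + Complex.I • f))‖ +
          ‖(R i ∘L V t - expGroup (A i) t ∘L R i) (g + Complex.I • f)‖ +
          ‖R i (V t (g + Complex.I • f)) - V t f‖ := by
          rw [h4]
          exact (norm_add_le _ _).trans (by gcongr; exact norm_sub_le _ _)
      _ < ε := by
          rw [norm_expGroup_apply (hA i)]
          linarith [h1 t ht, h2 t ht]

end TrotterKato

/-! ### Stone's theorem: existence of the unitary group -/

section Contraction

variable {E : Type*} [NormedAddCommGroup E] [NormedSpace ℂ E]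

/-- The strong limit of a sequence of contractions that converges on a dense set. -/
theorem exists_strong_limit [CompleteSpace E] {s : Set E} (hs : Dense s) {U : ℕ → E →L[ℂ] E}
    (hU : ∀ n f, ‖U n f‖ ≤ ‖f‖) (h : ∀ f ∈ s, CauchySeq fun n => U n f) :
    ∃ W : E →L[ℂ] E, ∀ f, Tendsto (fun n => U n f) atTop (𝓝 (W f)) := by
  have hC : ∀ f, CauchySeq fun n => U n f := by
    intro f
    -- The Cauchy property is read as convergence to zero of the differences indexed by pairs, to
    -- which the density lemma applies.
    have h1 := tendsto_zero_of_dense (l := atTop (α := ℕ × ℕ)) hs (P := fun p => U p.1 - U p.2)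
      (C := 2) (fun p f => ?_) (fun f hf => ?_) f
    · rw [cauchySeq_iff_tendsto_dist_atTop_0]
      simpa [dist_eq_norm] using h1.norm
    · calc ‖(U p.1 - U p.2) f‖ ≤ ‖U p.1 f‖ + ‖U p.2 f‖ := norm_sub_le _ _
        _ ≤ ‖f‖ + ‖f‖ := add_le_add (hU _ _) (hU _ _)
        _ = 2 * ‖f‖ := by ring
    · have h2 := cauchySeq_iff_tendsto_dist_atTop_0.1 (h f hf)
      rw [tendsto_zero_iff_norm_tendsto_zero]
      simpa [dist_eq_norm] using h2
  choose W hW using fun f => cauchySeq_tendsto_of_complete (hC f)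
  refine ⟨LinearMap.mkContinuous
    { toFun := W
      map_add' := fun f g => tendsto_nhds_unique (hW _)
        (((hW f).add (hW g)).congr fun n => ((U n).map_add f g).symm)
      map_smul' := fun c f => tendsto_nhds_unique (hW _)
        (((hW f).const_smul c).congr fun n => ((U n).map_smul c f).symm) } 1 fun f => ?_, hW⟩
  rw [one_mul]
  exact le_of_tendsto (hW f).norm (Eventually.of_forall fun n => hU n f)

end Contraction

variable {F : Type*} [NormedAddCommGroup F] [InnerProductSpace ℂ F] [CompleteSpace F]
  {Γ : Submodule ℂ (F × F)}

/-- The Yosida approximation: commuting bounded self-adjoint operators that converge strongly to a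
given self-adjoint operator on its domain. -/
theorem exists_commuting_approximation (hΓ : IsSelfAdjointGraph Γ)
    (hd : Dense {f | ∃ g, (f, g) ∈ Γ}) :
    ∃ Y : ℕ → F →L[ℂ] F, (∀ n, IsSelfAdjoint (Y n)) ∧ (∀ n k, Commute (Y n) (Y k)) ∧
      ∀ f g, (f, g) ∈ Γ → Tendsto (fun n => Y n f) atTop (𝓝 g) := by
  choose! R hR1 hR2 hR3 using fun (c : ℝ) (hc : c ≠ 0) => hΓ.exists_resolvent hc
  have hcomm : ∀ c ≠ 0, ∀ d ≠ 0, Commute (R c) (R d) := by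
    -- The first resolvent identity; exchanging `c` and `d` yields commutation.
    have key : ∀ c : ℝ, c ≠ 0 → ∀ d : ℝ, d ≠ 0 → ∀ f,
        R c f + ((c - d : ℂ) * Complex.I) • R c (R d f) = R d f := by
      intro c hc d hd f
      have h1 := hR2 c hc _ _ (hR1 d hd f)
      simp only [map_add, map_sub, map_smul] at h1
      rw [← sub_eq_zero] at h1 ⊢
      rw [← h1]
      module
    intro c hc d hd
    rcases eq_or_ne c d with rfl | hcd
    · exact Commute.refl _
    ext f
    have h1 := key c hc d hd f
    have h2 := key d hd c hc f
    have h3 : ((c - d : ℂ) * Complex.I) • (R c (R d f) - R d (R c f)) = 0 := by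
      have h4 : ((c - d : ℂ) * Complex.I) • R c (R d f) = R d f - R c f :=
        eq_sub_of_add_eq' h1
      have h5 : ((d - c : ℂ) * Complex.I) • R d (R c f) = R c f - R d f :=
        eq_sub_of_add_eq' h2
      have h6 : ((c - d : ℂ) * Complex.I) • R d (R c f) = R d f - R c f := by
        rw [← neg_sub (R c f), ← h5, ← neg_smul]; congr 1; ring
      rw [smul_sub, h4, h6, sub_self]
    rw [smul_eq_zero, sub_eq_zero] at h3
    refine h3.resolve_left (mul_ne_zero (sub_ne_zero.2 ?_) Complex.I_ne_zero)
    exact_mod_cast hcd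
  have hadj : ∀ c ≠ 0, ∀ f g, inner ℂ (R c f) g = inner ℂ f (R (-c) g) := by
    intro c hc f g
    have h1 := hΓ.inner_eq (hR1 (-c) (neg_ne_zero.2 hc) g) (hR1 c hc f)
    simp only [inner_sub_left, inner_sub_right, inner_smul_left, inner_smul_right, map_mul,
      Complex.conj_ofReal, Complex.conj_I, Complex.ofReal_neg] at h1
    linear_combination -h1
  have hone : ∀ (c : ℝ), c ≠ 0 → ∀ f, ‖(c * Complex.I : ℂ) • R c f‖ ≤ ‖f‖ := by
    intro c hc f
    rw [norm_smul]
    simpa using hR3 c hc f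
  have hE : ∀ c : ℕ → ℝ, (∀ n, c n ≠ 0) → Tendsto (fun n => |c n|) atTop atTop → ∀ f,
      Tendsto (fun n => (c n * Complex.I : ℂ) • R (c n) f) atTop (𝓝 f) := by
    intro c hc hlim f
    have h1 := tendsto_zero_of_dense (l := atTop) hd (C := 2)
      (P := fun n => (c n * Complex.I : ℂ) • R (c n) - 1) (fun n f => ?_) ?_ f
    · simpa using h1.add_const f
    · calc ‖((c n * Complex.I : ℂ) • R (c n) - 1) f‖
          ≤ ‖(c n * Complex.I : ℂ) • R (c n) f‖ + ‖f‖ := norm_sub_le _ _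
        _ ≤ ‖f‖ + ‖f‖ := by gcongr; exact hone _ (hc n) f
        _ = 2 * ‖f‖ := by ring
    · rintro f ⟨g, hf⟩
      have h2 : Tendsto (fun n => |c n|⁻¹ * ‖g‖) atTop (𝓝 0) := by
        simpa using hlim.inv_tendsto_atTop.mul_const ‖g‖
      refine squeeze_zero_norm (fun n => ?_) h2
      have h3 := hR2 (c n) (hc n) f g hf
      rw [map_add, map_smul] at h3
      have h4 : ((c n * Complex.I : ℂ) • R (c n) - 1) f = -R (c n) g := by
        change (c n * Complex.I : ℂ) • R (c n) f - f = _
        rw [sub_eq_iff_eq_add, ← sub_eq_neg_add]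
        exact eq_sub_of_add_eq' h3
      rw [h4, norm_neg, ← div_eq_inv_mul, le_div_iff₀ (abs_pos.2 (hc n)), mul_comm]
      exact hR3 _ (hc n) g
  have hc : ∀ n : ℕ, ((n : ℝ) + 1) ≠ 0 := fun n => by positivity
  have hc' : ∀ n : ℕ, -((n : ℝ) + 1) ≠ 0 := fun n => neg_ne_zero.2 (hc n)
  have hlim : Tendsto (fun n : ℕ => |(n : ℝ) + 1|) atTop atTop :=
    tendsto_abs_atTop_atTop.comp (tendsto_atTop_add_const_right _ _ tendsto_natCast_atTop_atTop)
  -- With `c = n + 1`, nonzero for every `n`, this is formally `c² L / (L² + c²)`. It is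
  -- self-adjoint because `R (-c)` is the adjoint of `R c`; on the domain it is the mean of
  -- `icR(c)L` and `-icR(-c)L`, both tending to `L`.
  refine ⟨fun n => ((((n : ℝ) + 1) ^ 2 / 2 : ℝ) : ℂ) • (R (n + 1) + R (-(n + 1))), fun n => ?_,
    fun n k => ?_, fun f g hf => ?_⟩
  · rw [ContinuousLinearMap.isSelfAdjoint_iff_isSymmetric]
    intro f g
    have h1 := hadj _ (hc n) f g
    have h2 := hadj _ (hc' n) f g
    rw [neg_neg] at h2
    simp only [ContinuousLinearMap.coe_coe, smul_apply, add_apply,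
      inner_smul_left, inner_smul_right, inner_add_left, inner_add_right, h1, h2, Complex.conj_ofReal]
    ring
  · refine (Commute.smul_right ?_ _).smul_left _
    exact ((hcomm _ (hc n) _ (hc k)).add_right (hcomm _ (hc n) _ (hc' k))).add_left
      ((hcomm _ (hc' n) _ (hc k)).add_right (hcomm _ (hc' n) _ (hc' k)))
  · have h1 := ((hE _ hc hlim g).add
      (hE (fun n => -((n : ℝ) + 1)) hc' (by simpa only [abs_neg] using hlim) g)).const_smul
        (2⁻¹ : ℂ)
    have h2 : (2⁻¹ : ℂ) • (g + g) = g := by module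
    rw [h2] at h1
    refine h1.congr fun n => ?_
    have h3 := hR2 _ (hc n) f g hf
    have h4 := hR2 _ (hc' n) f g hf
    have key : ∀ (c : ℂ) (x y u v : F), u + (c * Complex.I) • x = f →
        v + (-c * Complex.I) • y = f →
        (2⁻¹ : ℂ) • ((c * Complex.I) • u + (-c * Complex.I) • v) = (c ^ 2 / 2) • (x + y) := by
      intro c x y u v hu hv
      rw [← eq_sub_iff_add_eq] at hu hv
      rw [hu, hv]
      have hI : Complex.I * Complex.I = -1 := Complex.I_mul_I
      have e1 : (c * Complex.I) * (c * Complex.I) = -c ^ 2 := by linear_combination c ^ 2 * hI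
      have e2 : (-c * Complex.I) * (-c * Complex.I) = -c ^ 2 := by linear_combination c ^ 2 * hI
      rw [smul_sub, smul_sub, smul_smul _ _ x, smul_smul _ _ y, e1, e2]
      module
    rw [map_add, map_smul] at h3 h4
    have h5 := key ((n : ℝ) + 1) _ _ _ _ (by simpa using h3) (by simpa using h4)
    simpa using h5

/-- The existence part of Stone's theorem. -/
theorem exists_isGroupWithGraph (hΓ : IsSelfAdjointGraph Γ)
    (hd : Dense {f | ∃ g, (f, g) ∈ Γ}) : ∃ V : ℝ → F →L[ℂ] F, IsGroupWithGraph V Γ := by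
  obtain ⟨Y, hY, hcomm, hlim⟩ := exists_commuting_approximation hΓ hd
  have hex : ∀ t : ℝ, ∃ W : F →L[ℂ] F,
      ∀ f, Tendsto (fun n => expGroup (Y n) t f) atTop (𝓝 (W f)) := by
    intro t
    refine exists_strong_limit hd (fun n f => (norm_expGroup_apply (hY n) t f).le) ?_
    rintro f ⟨g, hf⟩
    have h1 := cauchySeq_iff_tendsto_dist_atTop_0.1 (hlim f g hf).cauchySeq
    rw [cauchySeq_iff_tendsto_dist_atTop_0]
    refine squeeze_zero (fun _ => dist_nonneg) (fun p => ?_) (by simpa using h1.const_mul |t|)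
    rw [dist_eq_norm, dist_eq_norm]
    exact norm_expGroup_sub_expGroup_le_of_commute (hY _) (hY _) (hcomm _ _) t f
  choose V hV using hex
  have hnorm : ∀ t f, ‖V t f‖ = ‖f‖ := fun t f => tendsto_nhds_unique (hV t f).norm
    (tendsto_const_nhds.congr fun n => (norm_expGroup_apply (hY n) t f).symm)
  have hinner : ∀ t f g, inner ℂ (V t f) g = inner ℂ f (V (-t) g) := fun t f g =>
    tendsto_nhds_unique ((hV t f).inner tendsto_const_nhds)
      ((tendsto_const_nhds.inner (hV (-t) g)).congr fun n =>
        (inner_expGroup_left (hY n) t f g).symm)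
  have hzero : V 0 = 1 := by
    ext f
    exact tendsto_nhds_unique (hV 0 f) (by simp)
  have htaylor : ∀ (t : ℝ) {f g f₁ g₁ : F}, (f, g) ∈ Γ → (f₁, g₁) ∈ Γ →
      ‖V t f - f - (t : ℂ) • Complex.I • g‖ ≤ (2 * ‖g - f₁‖ + |t| * ‖g₁‖) * |t| := by
    intro t f g f₁ g₁ hf hf₁
    have h1 := hlim f g hf
    have h2 := hlim f₁ g₁ hf₁
    refine le_of_tendsto_of_tendsto'
      (((hV t f).sub_const f).sub ((h1.const_smul Complex.I).const_smul (t : ℂ))).norm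
      ((((h1.sub_const f₁).norm.const_mul 2).add (h2.norm.const_mul |t|)).mul_const |t|)
      fun n => norm_expGroup_sub_sub_le (hY n) t f f₁
  have hderiv : ∀ {f g}, (f, g) ∈ Γ →
      Tendsto (fun t : ℝ => (t : ℂ)⁻¹ • (V t f - f)) (𝓝[≠] 0) (𝓝 (Complex.I • g)) := by
    intro f g hf
    refine Metric.tendsto_nhds.2 fun ε hε => ?_
    -- `g = L f` need not lie in the domain, so a nearby domain vector `f₁` is used in the Taylor
    -- bound.
    obtain ⟨f₁, hg, g₁, hf₁⟩ := Metric.dense_iff.1 hd g (ε / 4) (by positivity)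
    rw [Metric.mem_ball, dist_comm, dist_eq_norm] at hg
    have hsmall : Tendsto (fun t : ℝ => |t| * ‖g₁‖) (𝓝[≠] 0) (𝓝 0) := by
      have h1 : Continuous fun t : ℝ => |t| * ‖g₁‖ := by fun_prop
      simpa using (h1.tendsto 0).mono_left nhdsWithin_le_nhds
    filter_upwards [hsmall.eventually_lt_const (half_pos hε), self_mem_nhdsWithin] with t ht ht0
    have ht0' : (t : ℂ) ≠ 0 := Complex.ofReal_ne_zero.2 ht0
    have ht1 : 0 < |t| := abs_pos.2 ht0
    have h1 : (t : ℂ)⁻¹ • (V t f - f) - Complex.I • g =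
        (t : ℂ)⁻¹ • (V t f - f - (t : ℂ) • Complex.I • g) := by
      rw [smul_sub _ (V t f - f), inv_smul_smul₀ ht0']
    rw [dist_eq_norm, h1, norm_smul, norm_inv, Complex.norm_real, Real.norm_eq_abs,
      inv_mul_lt_iff₀ ht1]
    refine (htaylor t hf hf₁).trans_lt ?_
    rw [mul_comm]
    gcongr
    linarith
  have hadd : ∀ t s f, V (t + s) f = V t (V s f) := by
    intro t s f
    refine tendsto_nhds_unique (hV (t + s) f) ?_
    have h1 : Tendsto (fun n => expGroup (Y n) t (expGroup (Y n) s f - V s f)) atTop (𝓝 0) := by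
      rw [tendsto_zero_iff_norm_tendsto_zero]
      simp only [norm_expGroup_apply (hY _)]
      simpa using ((hV s f).sub_const (V s f)).norm
    simpa [expGroup_add_apply] using h1.add (hV t (V s f))
  refine ⟨V, ⟨hzero, fun t s => ContinuousLinearMap.ext (hadd t s), fun f => ?_⟩,
    fun f g => ⟨hderiv, fun h => ?_⟩⟩
  · rw [continuous_iff_continuousAt]
    intro t
    have h1 := tendsto_zero_of_dense (l := 𝓝 t) hd (P := fun s => V s - V t) (C := 2)
      (fun s f => ?_) ?_ f
    · simpa [ContinuousAt] using h1.add_const (V t f)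
    · calc ‖(V s - V t) f‖ ≤ ‖V s f‖ + ‖V t f‖ := norm_sub_le _ _
        _ = 2 * ‖f‖ := by rw [hnorm, hnorm]; ring
    · rintro f ⟨g, hf⟩
      have h2 : Tendsto (fun s : ℝ => |s - t| * ‖g‖) (𝓝 t) (𝓝 0) := by
        have h3 : Continuous fun s : ℝ => |s - t| * ‖g‖ := by fun_prop
        simpa using h3.tendsto t
      refine squeeze_zero_norm (fun s => ?_) h2
      exact le_of_tendsto_of_tendsto' ((hV s f).sub (hV t f)).norm
        ((hlim f g hf).norm.const_mul _) fun n => norm_expGroup_sub_expGroup_le (hY n) s t f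
  -- The generator is no larger than `iL`: since `V(t)* = V(-t)`, differentiating `⟨V(-t) a, f⟩ =
  -- ⟨a, V(t) f⟩` shows that `(f, g)` lies in the adjoint of `Γ`, which is `Γ`.
  · rw [hΓ]
    intro a b hab
    have h1 : Tendsto (fun t : ℝ => inner ℂ ((-t : ℂ)⁻¹ • (V (-t) a - a)) f) (𝓝[≠] 0)
        (𝓝 (inner ℂ (Complex.I • b) f)) := by
      have h2 : Tendsto (fun t : ℝ => -t) (𝓝[≠] 0) (𝓝[≠] 0) := by
        refine tendsto_nhdsWithin_iff.2 ⟨?_, ?_⟩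
        · simpa using (continuous_neg.tendsto (0 : ℝ)).mono_left nhdsWithin_le_nhds
        · filter_upwards [self_mem_nhdsWithin] with t ht
          simpa using ht
      have h3 := (hderiv hab).comp h2
      simp only [Function.comp_def, Complex.ofReal_neg] at h3
      exact h3.inner tendsto_const_nhds
    have h2 : Tendsto (fun t : ℝ => -inner ℂ a ((t : ℂ)⁻¹ • (V t f - f))) (𝓝[≠] 0)
        (𝓝 (-inner ℂ a (Complex.I • g))) := (tendsto_const_nhds.inner h).neg
    have h3 := tendsto_nhds_unique h1 (h2.congr fun t => ?_)
    · rw [inner_smul_left, inner_smul_right, Complex.conj_I] at h3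
      have h4 : Complex.I * (inner ℂ b f - inner ℂ a g) = 0 := by linear_combination -h3
      exact sub_eq_zero.1 ((mul_eq_zero.1 h4).resolve_left Complex.I_ne_zero)
    · rw [inner_smul_left, inner_smul_right, inner_sub_left, inner_sub_right, hinner, neg_neg,
        map_inv₀, map_neg, Complex.conj_ofReal]
      rw [inv_neg]
      ring

/-! ### Expansions of powers and exponentials -/

section Expansion

theorem sum_smul_pow {ι R : Type*} [Fintype ι] [Ring R] [Algebra ℂ R] (c : ι → ℂ) (x : ι → R)
    (p : ℕ) :
    (∑ k, c k • x k) ^ p =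
      ∑ k : Fin p → ι, (∏ i, c (k i)) • (List.ofFn fun i => x (k i)).prod := by
  induction p with
  | zero => simp
  | succ p ih =>
    rw [pow_succ', ih, ← (Fin.consEquiv fun _ : Fin (p + 1) => ι).sum_comp,
      Fintype.sum_prod_type, Finset.sum_mul_sum]
    refine Finset.sum_congr rfl fun a _ => Finset.sum_congr rfl fun k _ => ?_
    simp [Fin.consEquiv, Fin.prod_univ_succ, List.ofFn_succ, smul_smul, mul_comm (c a)]

variable {𝔸 : Type*} [NormedRing 𝔸] [NormedAlgebra ℂ 𝔸] [CompleteSpace 𝔸]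

theorem tendsto_exp_sum_range (x : 𝔸) :
    Tendsto (fun j : ℕ => ∑ p ∈ Finset.range (j + 1), ((p ! : ℂ)⁻¹) • x ^ p) atTop
      (𝓝 (NormedSpace.exp x)) :=
  (NormedSpace.exp_series_hasSum_exp' (𝕂 := ℂ) x).tendsto_sum_nat.comp (tendsto_add_atTop_nat 1)

/-- Euler's limit `(1 + x / p) ^ p → exp x`, with the power expanded. -/
theorem tendsto_euler_sum (x : 𝔸) :
    Tendsto (fun p : ℕ => ∑ d ∈ Finset.range (p + 1), ((p.choose d : ℂ) / (p : ℂ) ^ d) • x ^ d)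
      atTop (𝓝 (NormedSpace.exp x)) := by
  have hsum : ∀ p : ℕ, ∑' d : ℕ, ((p.choose d : ℂ) / (p : ℂ) ^ d) • x ^ d =
      ∑ d ∈ Finset.range (p + 1), ((p.choose d : ℂ) / (p : ℂ) ^ d) • x ^ d := by
    intro p
    refine tsum_eq_sum fun d hd => ?_
    rw [Nat.choose_eq_zero_of_lt (by simpa [Nat.lt_succ_iff] using hd)]
    simp
  -- The Poisson limit of binomial coefficients with success probability `1/p`, whose mean is 1.
  have hreal : ∀ d : ℕ, Tendsto (fun p : ℕ => (p.choose d : ℝ) * (1 / (p : ℝ)) ^ d) atTop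
      (𝓝 (1 ^ d / (d ! : ℝ))) := fun d => by
    refine ProbabilityTheory.tendsto_choose_mul_pow_atTop d (tendsto_const_nhds.congr' ?_)
    filter_upwards [eventually_ne_atTop 0] with p hp
    have : (p : ℝ) ≠ 0 := Nat.cast_ne_zero.2 hp
    field_simp
  have hcoef : ∀ d : ℕ, Tendsto (fun p : ℕ => (p.choose d : ℂ) / (p : ℂ) ^ d) atTop
      (𝓝 ((d ! : ℂ)⁻¹)) := fun d => by
    have h := (Complex.continuous_ofReal.tendsto _).comp (hreal d)
    simpa [Function.comp_def, div_eq_mul_inv] using h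
  rw [← (NormedSpace.exp_series_hasSum_exp' (𝕂 := ℂ) x).tsum_eq]
  simp only [← hsum]
  -- The bound `choose p d ≤ p ^ d / d!` makes the exponential series a dominating series; `p = 0`
  -- is checked apart.
  refine tendsto_tsum_of_dominated_convergence
    (bound := fun d : ℕ => ‖((d ! : ℂ)⁻¹) • x ^ d‖)
    (NormedSpace.norm_expSeries_summable' (𝕂 := ℂ) x)
    (fun d => (hcoef d).smul_const _) (Eventually.of_forall fun p d => ?_)
  rw [norm_smul, norm_smul]
  gcongr
  rw [norm_div, norm_pow, norm_inv, Complex.norm_natCast, Complex.norm_natCast,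
    Complex.norm_natCast]
  rcases Nat.eq_zero_or_pos p with rfl | hp
  · rcases Nat.eq_zero_or_pos d with rfl | hd'
    · simp
    · simp [Nat.choose_eq_zero_of_lt hd']
  · have hp' : (0 : ℝ) < (p : ℝ) ^ d := by positivity
    rw [div_le_iff₀ hp', inv_mul_eq_div]
    exact Nat.choose_le_pow_div d p

end Expansion

/-! ### The family `R(t)` as a unitary group with a varying bounded generator -/

section Family

variable {F : Type*} [NormedAddCommGroup F]

section Normed

variable [NormedSpace ℂ F] {m : ℕ} (a : Fin m → ℂ) (S : Fin m → ℝ → F →L[ℂ] F)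

/-- The operator `S(s) - a I`. -/
noncomputable def shiftedSum (s : ℝ) : F →L[ℂ] F :=
  ∑ k, a k • (S k s - 1)

theorem shiftedSum_eq (s : ℝ) :
    shiftedSum a S s = (∑ k, a k • S k s) - (∑ k, a k) • (1 : F →L[ℂ] F) := by
  simp [shiftedSum, smul_sub, Finset.sum_smul]

theorem exponent_eq (t : ℝ) :
    exponent a S t = (Complex.I * (Real.sign t : ℂ)) • shiftedSum a S |t| := rfl

/-- The extra index `m + 1` contributes `-a I`, so the multiple sum is the noncommutative expansion
of `(S(s) - aI) ^ p`. -/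
theorem multiSum_eq (p : ℕ) (s : ℝ) (f : F) :
    multiSum a S p s f = (shiftedSum a S s ^ p) f := by
  have h : shiftedSum a S s = ∑ k, extCoeff a k • extFamily S k s := by
    rw [shiftedSum_eq, Fin.sum_univ_castSucc]
    simp [extCoeff, extFamily, sub_eq_add_neg]
  rw [h, sum_smul_pow, multiSum]
  simp

theorem smul_exponent_div {n : ℕ} (hn : 1 ≤ n) (t : ℝ) :
    (n : ℂ) • exponent a S (t / n) =
      (Complex.I * n * (Real.sign t : ℂ)) • shiftedSum a S (|t| / n) := by
  have hn' : (0 : ℝ) < n := by exact_mod_cast hn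
  have h1 : Real.sign (t / n) = Real.sign t := by
    rcases lt_trichotomy t 0 with ht | rfl | ht
    · rw [Real.sign_of_neg ht, Real.sign_of_neg (div_neg_of_neg_of_pos ht hn')]
    · simp
    · rw [Real.sign_of_pos ht, Real.sign_of_pos (div_pos ht hn')]
  rw [exponent_eq, h1, abs_div, abs_of_pos hn', smul_smul]
  congr 1
  ring

theorem expFamily_pow [CompleteSpace F] {n : ℕ} (hn : 1 ≤ n) (t : ℝ) :
    expFamily a S (t / n) ^ n =
      NormedSpace.exp ((Complex.I * n * (Real.sign t : ℂ)) • shiftedSum a S (|t| / n)) := by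
  let _ : NormedAlgebra ℚ (F →L[ℂ] F) := NormedAlgebra.restrictScalars ℚ ℂ _
  rw [← smul_exponent_div a S hn, expFamily, ← NormedSpace.exp_nsmul, Nat.cast_smul_eq_nsmul]

theorem expFamily_zero : expFamily a S 0 = 1 := by
  simp [expFamily, exponent, NormedSpace.exp_zero]

theorem IsC0Group.map_nat_mul {V : ℝ → F →L[ℂ] F} (hV : IsC0Group V) (n : ℕ) (s : ℝ) :
    V (n * s) = V s ^ n := by
  induction n with
  | zero => simpa using hV.map_zero
  | succ n ih =>
    rw [Nat.cast_succ, add_mul, one_mul, hV.map_add, ih, pow_succ]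
    rfl

theorem IsC0Group.map_div_pow {V : ℝ → F →L[ℂ] F} (hV : IsC0Group V) {n : ℕ} (hn : 1 ≤ n)
    (t : ℝ) : V (t / n) ^ n = V t := by
  rw [← hV.map_nat_mul, mul_div_cancel₀ _ (by positivity)]

/-- The difference quotient `(S(|s|) - a I) / s`. -/
noncomputable def quotient (s : ℝ) : F →L[ℂ] F :=
  ((s⁻¹ : ℝ) : ℂ) • shiftedSum a S |s|

theorem tendsto_quotient {D : Submodule ℂ F} {Lk : Fin m → F →ₗ.[ℂ] F}
    (hS : ∀ k, IsChernoffTangentOn D (S k) (Lk k)) {f g : F}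
    (hf : (f, g) ∈ ((∑ k, a k • Lk k).domRestrict D).graph) :
    Tendsto (fun s => quotient a S s f) (𝓝[>] 0) (𝓝 g) := by
  obtain ⟨⟨f', hfD, hfs⟩, rfl, hfg⟩ := (LinearPMap.mem_graph_iff _).1 hf
  have hk : ∀ k y, (f', y) ∈ (Lk k).graph →
      Tendsto (fun t : ℝ => (t : ℂ)⁻¹ • (S k t f' - f')) (𝓝[>] 0) (𝓝 y) := by
    intro k y hy
    obtain ⟨A, rfl, hA, -, hAL⟩ := (hS k).hasClosure_deriv
    have h1 : (f', A ⟨f', hfD⟩) ∈ (Lk k).graph :=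
      -- `L_k` extends `S_k'(0)`, so on `D` the derivative at zero must be the value of `L_k`.
      hAL ▸ LinearPMap.le_graph_of_le A.le_closure (A.mem_graph ⟨f', hfD⟩)
    rw [LinearPMap.mem_graph_snd_inj _ hy h1 rfl]
    exact hA ⟨f', hfD⟩
  have hsum : ∀ (s : Finset (Fin m)) (y : F), (f', y) ∈ (∑ k ∈ s, a k • Lk k).graph →
      Tendsto (fun t : ℝ => ∑ k ∈ s, a k • (t : ℂ)⁻¹ • (S k t f' - f')) (𝓝[>] 0) (𝓝 y) := by
    intro s
    induction s using Finset.induction_on with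
    | empty =>
      intro y hy
      obtain ⟨z, -, hz⟩ := (LinearPMap.mem_graph_iff _).1 hy
      have hy0 : y = 0 := hz.symm
      simp [hy0]
    | insert k s hks ih =>
      intro y hy
      rw [Finset.sum_insert hks] at hy
      obtain ⟨⟨z, hz1, hz2⟩, rfl, hz⟩ := (LinearPMap.mem_graph_iff _).1 hy
      simp only [Finset.sum_insert hks]
      change _ = y at hz
      rw [← hz, LinearPMap.add_apply]
      exact ((hk k _ ((Lk k).mem_graph ⟨z, hz1⟩)).const_smul (a k)).add
        (ih _ (LinearPMap.mem_graph _ ⟨z, hz2⟩))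
  have hmem : (f', g) ∈ (∑ k, a k • Lk k).graph :=
    LinearPMap.le_graph_of_le LinearPMap.domRestrict_le hf
  refine (hsum Finset.univ g hmem).congr' ?_
  filter_upwards [self_mem_nhdsWithin] with t ht
  rw [quotient, abs_of_pos ht, Complex.ofReal_inv]
  simp [shiftedSum, Finset.smul_sum, smul_smul, mul_comm]

end Normed

variable [InnerProductSpace ℂ F] [CompleteSpace F] {m : ℕ} {a : Fin m → ℂ}
  {S : Fin m → ℝ → F →L[ℂ] F}

/-- Reality of `a` enters here. The absolute value in `quotient` gives self-adjointness for every
real `s`, so no restriction on the filter index is needed. -/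
theorem isSelfAdjoint_quotient (hS : ∀ t : ℝ, 0 ≤ t → IsSelfAdjoint (∑ k, a k • S k t))
    (ha : (∑ k, a k).im = 0) (s : ℝ) : IsSelfAdjoint (quotient a S s) := by
  have h1 : star (∑ k, a k) = ∑ k, a k := Complex.conj_eq_iff_im.2 ha
  have h2 : star ((s⁻¹ : ℝ) : ℂ) = ((s⁻¹ : ℝ) : ℂ) := Complex.conj_ofReal _
  rw [IsSelfAdjoint, quotient, shiftedSum_eq, star_smul, star_sub, star_smul, star_one,
    (hS _ (abs_nonneg s)).star_eq, h1, h2]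

theorem expFamily_div_pow_eq_expGroup {n : ℕ} (hn : 1 ≤ n) {t : ℝ} (ht : t ≠ 0) :
    expFamily a S (t / n) ^ n = expGroup (quotient a S (|t| / n)) t := by
  have hn' : (0 : ℝ) < n := by exact_mod_cast hn
  rw [expFamily_pow a S hn, expGroup, quotient, abs_of_nonneg (a := |t| / n) (by positivity),
    smul_smul, smul_smul]
  congr 2
  have h1 : (Real.sign t : ℂ) = t * ((|t| : ℝ) : ℂ)⁻¹ := by
    rcases lt_or_gt_of_ne ht with h | h
    · rw [Real.sign_of_neg h, abs_of_neg h]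
      push_cast
      rw [inv_neg, mul_neg, mul_inv_cancel₀ (by exact_mod_cast ht)]
    · rw [Real.sign_of_pos h, abs_of_pos h]
      push_cast
      rw [mul_inv_cancel₀ (by exact_mod_cast ht)]
  rw [h1]
  push_cast
  rw [inv_div]
  ring

theorem eventually_norm_expFamily_sub_lt {V : ℝ → F →L[ℂ] F} {Γ Γ₀ : Submodule ℂ (F × F)}
    (hV : IsGroupWithGraph V Γ) (hΓ : IsSelfAdjointGraph Γ) (hd : Dense {f | ∃ g, (f, g) ∈ Γ})
    (hΓ₀ : Γ₀.topologicalClosure = Γ)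
    (hS : ∀ t : ℝ, 0 ≤ t → IsSelfAdjoint (∑ k, a k • S k t)) (ha : (∑ k, a k).im = 0)
    (hcore : ∀ f g, (f, g) ∈ Γ₀ → Tendsto (fun s => quotient a S s f) (𝓝[>] 0) (𝓝 g))
    (f : F) (T : ℝ) {ε : ℝ} (hε : 0 < ε) :
    ∀ᶠ n : ℕ in atTop, ∀ t ∈ Set.Icc (-T) T, ‖(expFamily a S (t / n) ^ n) f - V t f‖ < ε := by
  have h := eventually_norm_expGroup_sub_lt hV hΓ hd hΓ₀
    (isSelfAdjoint_quotient hS ha) hcore T f ε hε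
  -- The estimate holds for all `s` in `(0, δ)` and all times in `[-T, T]` independently, so `s =
  -- |t|/n` may be substituted once `|T|/n < δ`.
  obtain ⟨δ, hδ, hδ'⟩ := (mem_nhdsGT_iff_exists_Ioo_subset).1 h
  have hlim : Tendsto (fun n : ℕ => |T| / n) atTop (𝓝 0) :=
    tendsto_const_div_atTop_nhds_zero_nat _
  filter_upwards [hlim.eventually_lt_const hδ, eventually_ge_atTop 1] with n hn hn1 t ht
  rcases eq_or_ne t 0 with rfl | ht0
  · simpa [expFamily_zero, hV.isC0Group.map_zero] using hε
  · have hn' : (0 : ℝ) < n := by exact_mod_cast hn1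
    rw [expFamily_div_pow_eq_expGroup hn1 ht0]
    refine hδ' ⟨div_pos (abs_pos.2 ht0) hn', lt_of_le_of_lt ?_ hn⟩ t ht
    refine div_le_div_of_nonneg_right ?_ hn'.le
    exact (abs_le.2 ht).trans (le_abs_self T)

end Family

end QuasiFeynman

/-! ### The main theorem -/

theorem theorem1 {F : Type*} [NormedAddCommGroup F] [InnerProductSpace ℂ F] [CompleteSpace F]
    {m : ℕ} (Lk : Fin m → F →ₗ.[ℂ] F) (a : Fin m → ℂ) (ha : ∀ k, a k ≠ 0)
    (S : Fin m → ℝ → F →L[ℂ] F) (D : Submodule ℂ F)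
    (hS : ∀ k, QuasiFeynman.IsChernoffTangentOn D (S k) (Lk k))
    (L : F →ₗ.[ℂ] F)
    (hL : QuasiFeynman.HasClosure ((∑ k, a k • Lk k).domRestrict D) L)
    (hLsa : IsSelfAdjoint L)
    (hSsa : ∀ t : ℝ, 0 ≤ t → IsSelfAdjoint (∑ k, a k • S k t))
    (ha_real : (∑ k, a k).im = 0) :
    (∃ V : ℝ → F →L[ℂ] F,
      QuasiFeynman.IsC0Group V ∧ QuasiFeynman.IsGenerator V (Complex.I • L)) ∧
    (∀ t : ℝ,
      HasSum (fun j : ℕ => ((j ! : ℂ)⁻¹) • QuasiFeynman.exponent a S t ^ j)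
        (QuasiFeynman.expFamily a S t) ∧
      QuasiFeynman.expFamily a S t =
        NormedSpace.exp ((Complex.I * (Real.sign t : ℂ)) •
          ((∑ k, a k • S k |t|) - (∑ k, a k) • (1 : F →L[ℂ] F)))) ∧
    ∀ V : ℝ → F →L[ℂ] F,
      QuasiFeynman.IsC0Group V → QuasiFeynman.IsGenerator V (Complex.I • L) →
      QuasiFeynman.IsChernoffEquivalent (QuasiFeynman.expFamily a S) V ∧
      (∀ (t : ℝ) (f : F),
        Tendsto (fun n : ℕ => (QuasiFeynman.expFamily a S (t / n) ^ n) f) atTop (𝓝 (V t f))) ∧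
      (∀ (f : F) (t : ℝ),
        QuasiFeynman.HasIteratedLimit
          (fun n j : ℕ => ∑ p ∈ Finset.range (j + 1),
            ((Complex.I * n * (Real.sign t : ℂ)) ^ p / (p ! : ℂ)) •
              QuasiFeynman.multiSum a S p (|t| / n) f)
          (V t f)) ∧
      (∀ (f : F) (t : ℝ),
        QuasiFeynman.HasIteratedLimit
          (fun n p : ℕ => (p ! : ℂ) • ∑ d ∈ Finset.range (p + 1),
            ((Complex.I * n * (Real.sign t : ℂ)) ^ d /
                ((p : ℂ) ^ d * (d ! : ℂ) * ((p - d)! : ℂ))) •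
              QuasiFeynman.multiSum a S d (|t| / n) f)
          (V t f)) := by
  have hΓ := QuasiFeynman.isSelfAdjointGraph_graph hLsa
  have hd : Dense {f | ∃ g, (f, g) ∈ L.graph} := by
    simp only [← LinearPMap.mem_domain_iff]
    exact hLsa.dense_domain
  -- This is the statement that `D` is a core of `L`.
  have hΓ₀ : ((∑ k, a k • Lk k).domRestrict D).graph.topologicalClosure = L.graph := by
    rw [hL.1.graph_closure_eq_closure_graph, hL.2]
  refine ⟨?_, fun t => ⟨?_, ?_⟩, fun V hV hVgen => ?_⟩
  · obtain ⟨V, hV⟩ := QuasiFeynman.exists_isGroupWithGraph hΓ hd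
    exact ⟨V, hV.isC0Group, QuasiFeynman.isGenerator_I_smul_iff.2 hV.mem_iff⟩
  · exact NormedSpace.exp_series_hasSum_exp' _
  · rw [QuasiFeynman.expFamily, QuasiFeynman.exponent_eq, QuasiFeynman.shiftedSum_eq]
  have hVΓ : QuasiFeynman.IsGroupWithGraph V L.graph :=
    ⟨hV, QuasiFeynman.isGenerator_I_smul_iff.1 hVgen⟩
  have hunif := fun f T ε hε => QuasiFeynman.eventually_norm_expFamily_sub_lt (ε := ε) hVΓ hΓ hd hΓ₀
    hSsa ha_real (fun f g => QuasiFeynman.tendsto_quotient a S hS) f T hε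
  have hpoint : ∀ (t : ℝ) (f : F),
      Tendsto (fun n : ℕ => (QuasiFeynman.expFamily a S (t / n) ^ n) f) atTop (𝓝 (V t f)) := by
    intro t f
    refine Metric.tendsto_nhds.2 fun ε hε => ?_
    filter_upwards [hunif f |t| ε hε] with n hn
    rw [dist_eq_norm]
    exact hn t ⟨neg_abs_le t, le_abs_self t⟩
  refine ⟨⟨QuasiFeynman.expFamily_zero a S, hV.map_zero, fun f T _ => ?_⟩, hpoint,
    fun f t => ⟨fun n => (QuasiFeynman.expFamily a S (t / n) ^ n) f, fun n hn => ?_, hpoint t f⟩,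
    fun f t => ⟨fun n => (QuasiFeynman.expFamily a S (t / n) ^ n) f, fun n hn => ?_, hpoint t f⟩⟩
  · rw [ENNReal.tendsto_nhds_zero]
    intro ε hε
    obtain ⟨δ, hδ, hδε⟩ := ENNReal.lt_iff_exists_nnreal_btwn.1 hε
    -- The condition `n ≥ 1` is what allows `V (t / n) ^ n` to be replaced by `V t`.
    filter_upwards [hunif f T δ (by exact_mod_cast hδ), eventually_ge_atTop 1] with n hn hn1
    refine iSup₂_le fun t ht => le_trans ?_ hδε.le
    rw [hV.map_div_pow hn1, ← ofReal_norm]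
    exact ENNReal.ofReal_le_of_le_toReal (hn t ht).le
  · beta_reduce
    rw [QuasiFeynman.expFamily_pow a S hn]
    refine (((ContinuousLinearMap.apply ℂ F f).continuous.tendsto _).comp
      (QuasiFeynman.tendsto_exp_sum_range _)).congr fun j => ?_
    simp only [Function.comp_apply, map_sum]
    refine Finset.sum_congr rfl fun p _ => ?_
    rw [QuasiFeynman.multiSum_eq, smul_pow, smul_smul, ContinuousLinearMap.apply_apply,
      smul_apply]
    congr 1
    ring
  · beta_reduce
    rw [QuasiFeynman.expFamily_pow a S hn]
    refine (((ContinuousLinearMap.apply ℂ F f).continuous.tendsto _).comp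
      (QuasiFeynman.tendsto_euler_sum _)).congr fun p => ?_
    simp only [Function.comp_apply, map_sum, Finset.smul_sum]
    refine Finset.sum_congr rfl fun d hd => ?_
    rw [QuasiFeynman.multiSum_eq, smul_pow, smul_smul, ContinuousLinearMap.apply_apply,
      smul_apply, smul_smul,
      Nat.cast_choose ℂ (Nat.lt_succ_iff.1 (Finset.mem_range.1 hd))]
    congr 1
    rw [div_div, div_mul_eq_mul_div, mul_div_assoc']
    congr 1
    ring
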